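/- Let $K$ be a field, $n\ge 0$ an integer, $S=K[x_1,\dots,x_n]$, and let $\Delta$ be a simplicial complex on $[n]=\{1,\dots,n\}$, i.e. a collection of subsets of $[n]$ closed under taking subsets (singletons need not belong to $\Delta$). Let $I_\Delta\subseteq S$ be its Stanley–Reisner ideal, generated by the monomials $x_N=\prod_{j\in N}x_j$ with $N\subseteq[n]$, $N\notin\Delta$. A monomial ideal $J\subseteq S[y]$ is a *separation* of an ideal $I\subseteq S$ for the variable $x_i$ if (i) $I$ is the image of $J$ under the $K$-algebra homomorphism $S[y]\to S$ with $y\mapsto x_i$ and $x_j\mapsto x_j$ for all $j$; (ii) $x_i$ divides some minimal monomial generator of $J$, and $y$ divides some minimal monomial generator of $J$; (iii) $y-x_i$ is a non-zerodivisor on $S[y]/J$. The complex $\Delta$ is *inseparable* if $I_\Delta$ admits no separation for any of the variables $x_1,\dots,x_n$. For $i\in[n]$ let $N_{\{i\}}(\Delta)=\{F\in\Delta : i\notin F,\ F\cup\{i\}\notin\Delta\}$, and let $G_{\{i\}}(\Delta)$ be the graph with vertex set $N_{\{i\}}(\Delta)$ in which $\{F,G\}$ is an edge if and only if $F\subsetneq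 G$ or $G\subsetneq F$. Let $T^1(\Delta)$ be the cokernel of the map $\operatorname{Der}_K(S)\to\operatorname{Hom}_S(I_\Delta,S/I_\Delta)$, $\partial\mapsto(f\mapsto \partial f+I_\Delta)$. It is $\mathbb Z^n$-graded; $T^1(\Delta)_c$ denotes its component of degree $c\in\mathbb Z^n$, consisting of the classes of the homogeneous homomorphisms $I_\Delta\to S/I_\Delta$ of degree $c$, and $e_i$ denotes the $i$-th canonical basis vector of $\mathbb Z^n$. Then the following conditions are equivalent: (a) $\Delta$ is inseparable; (b) $G_{\{i\}}(\Delta)$ is connected for $i=1,\dots,n$, where the graph without vertices counts as connected; (c) $T^1(\Delta)_{-e_i}=0$ for $i=1,\dots,n$. -/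

import Mathlib

open MvPolynomial

noncomputable section

/-- A simplicial complex on the vertex set `V`: a collection of finite subsets of `V` closed under
passing to subsets. The empty set may be a face, singletons need not be faces, and the empty
collection is allowed. -/
abbrev SimplicialCpx (V : Type*) := LowerSet (Finset V)

namespace SimplicialCpx

variable {V : Type*}

/-- The Stanley–Reisner ideal, generated by the monomials `x_N` with `N` a non-face. -/
def stanleyReisnerIdeal (K : Type*) [Field K] (Δ : SimplicialCpx V) : Ideal (MvPolynomial V K) :=
  Ideal.span {f | ∃ N : Finset V, N ∉ Δ ∧ f = ∏ j ∈ N, X j}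

/-- `N_B(Δ)`: the faces `F` disjoint from `B` such that `F ∪ B` is not a face. -/
def nonJoinable [DecidableEq V] (Δ : SimplicialCpx V) (B : Finset V) : Set (Finset V) :=
  {F | F ∈ Δ ∧ Disjoint F B ∧ F ∪ B ∉ Δ}

/-- The graph `G_B(Δ)` on `N_B(Δ)` whose edges are given by strict inclusion. -/
def inclusionGraph [DecidableEq V] (Δ : SimplicialCpx V) (B : Finset V) :
    SimpleGraph (Δ.nonJoinable B) where
  Adj F G := F.1 ⊂ G.1 ∨ G.1 ⊂ F.1
  symm := ⟨fun _ _ h => h.symm⟩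
  loopless := ⟨fun _ h => h.elim (fun h => (ssubset_irrefl _ h).elim)
    (fun h => (ssubset_irrefl _ h).elim)⟩

end SimplicialCpx

section Separation

variable {V K : Type*} [Field K]

/-- Ideals generated by monomials. -/
def IsMonomialIdeal (J : Ideal (MvPolynomial V K)) : Prop :=
  ∃ A : Set (V →₀ ℕ), J = Ideal.span ((fun a => monomial a (1 : K)) '' A)

/-- `x^a` is a minimal monomial generator of the monomial ideal `J`: it is a monomial of `J` that is
minimal with respect to divisibility. -/
def IsMinimalGenerator (J : Ideal (MvPolynomial V K)) (a : V →₀ ℕ) : Prop :=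
  Minimal (fun b => monomial b (1 : K) ∈ J) a

/-- The `K`-algebra homomorphism `S[y] → S`, `y ↦ x_i`, `x_j ↦ x_j`. The ring `S[y]` is the
polynomial ring on `Option V`, with `y = X none` and `x_j = X (some j)`. -/
def specializeY (i : V) : MvPolynomial (Option V) K →ₐ[K] MvPolynomial V K :=
  aeval (fun o => o.elim (X i) X)

/-- `J ⊆ S[y]` is a separation of `I ⊆ S` for the variable `x_i`. -/
structure IsSeparation (I : Ideal (MvPolynomial V K)) (i : V)
    (J : Ideal (MvPolynomial (Option V) K)) : Prop where
  isMonomialIdeal : IsMonomialIdeal J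
  image_eq : specializeY i '' (J : Set (MvPolynomial (Option V) K)) = I
  x_dvd : ∃ a, IsMinimalGenerator J a ∧
    (X (some i) : MvPolynomial (Option V) K) ∣ monomial a 1
  y_dvd : ∃ a, IsMinimalGenerator J a ∧
    (X none : MvPolynomial (Option V) K) ∣ monomial a 1
  nonZeroDivisor : Ideal.Quotient.mk J (X none - X (some i)) ∈
    nonZeroDivisors (MvPolynomial (Option V) K ⧸ J)

/-- `Δ` is inseparable (over `K`): its Stanley–Reisner ideal admits no separation for any
variable. -/
def SimplicialCpx.IsInseparable (K : Type*) [Field K] (Δ : SimplicialCpx V) : Prop :=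
  ¬ ∃ (i : V) (J : Ideal (MvPolynomial (Option V) K)),
    IsSeparation (Δ.stanleyReisnerIdeal K) i J

end Separation

section Cotangent

variable {V K : Type*} [Field K]

/-- The natural map `δ* : Der_K(S) → Hom_S(I, S/I)`, `∂ ↦ (f ↦ ∂f + I)`. -/
def deltaStar (I : Ideal (MvPolynomial V K)) :
    Derivation K (MvPolynomial V K) (MvPolynomial V K) →ₗ[MvPolynomial V K]
      (I →ₗ[MvPolynomial V K] MvPolynomial V K ⧸ I) where
  toFun D :=
    { toFun := fun f => Ideal.Quotient.mk I (D f)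
      map_add' := fun f g => by simp
      map_smul' := fun s f => by
        have h : (f : MvPolynomial V K) * D s ∈ I := I.mul_mem_right _ f.2
        simp only [SetLike.val_smul, smul_eq_mul, Derivation.leibniz, map_add, RingHom.id_apply]
        rw [Ideal.Quotient.eq_zero_iff_mem.mpr h, add_zero]
        rfl }
  map_add' D E := by ext f; simp
  map_smul' s D := by ext f; rfl

/-- The first cotangent module `T¹(S/I)`: the cokernel of `δ*`. -/
abbrev CotangentT1 (I : Ideal (MvPolynomial V K)) : Type _ :=
  (I →ₗ[MvPolynomial V K] MvPolynomial V K ⧸ I) ⧸ LinearMap.range (deltaStar I)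

/-- The component of `S/I` in degree `d ∈ ℤ^V`; it is zero if `d` has a negative entry. -/
def quotientComponent (I : Ideal (MvPolynomial V K)) (d : V → ℤ) :
    Submodule K (MvPolynomial V K ⧸ I) :=
  Submodule.span K {q | ∃ a : V →₀ ℕ, (∀ j, (a j : ℤ) = d j) ∧
    q = Ideal.Quotient.mk I (monomial a 1)}

/-- The homogeneous homomorphisms `I → S/I` of degree `c ∈ ℤ^V`: those that map `I_a` to
`(S/I)_{a+c}` for every `a`. -/
def homComponent (I : Ideal (MvPolynomial V K)) (c : V → ℤ) :
    Submodule K (I →ₗ[MvPolynomial V K] MvPolynomial V K ⧸ I) where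
  carrier := {φ | ∀ (a : V →₀ ℕ) (r : K) (h : monomial a r ∈ I),
    φ ⟨monomial a r, h⟩ ∈ quotientComponent I (fun j => (a j : ℤ) + c j)}
  add_mem' hφ hψ a r h := Submodule.add_mem _ (hφ a r h) (hψ a r h)
  zero_mem' _ _ _ := Submodule.zero_mem _
  smul_mem' k _ hφ a r h := Submodule.smul_mem _ k (hφ a r h)

/-- The component `T¹(S/I)_c` of degree `c ∈ ℤ^V` for a monomial ideal `I`: the classes of the
homogeneous homomorphisms of degree `c`. -/
def cotangentT1Component (I : Ideal (MvPolynomial V K)) (c : V → ℤ) :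
    Submodule K (CotangentT1 I) :=
  (homComponent I c).map ((LinearMap.range (deltaStar I)).mkQ.restrictScalars K)

end Cotangent

end

/-! All three conditions compare a two-valued or scalar labelling of the vertices of `G_{i}(Δ)` with
the constant ones. By `preconnected_inclusionGraph_iff`, connectedness says that a vertex set
saturated under inclusion is empty or everything.

Cotangent side: a homomorphism of degree `-e_i` sends `x_i x_F` to `λ_F x_F`, and `x_F` is nonzero
modulo `I` for a vertex `F`. Multiplying by `x_{G \ F}` shows `λ_F = λ_G` whenever `F ⊆ G`, so `λ`
is constant on components. On all other monomials the homomorphism vanishes or is forced by `λ`.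
Derivations realise exactly the constant `λ`: `c ∂/∂x_i` has `λ = c`, and Leibniz makes any
derivation constant (`coeff_derivation_monomial_add_single`). Conversely, the indicator of a
saturated set extends to a homomorphism (`divOnHom`).

Separation side: for each vertex `F`, a separation contains exactly one of `x_i x_F` and `y x_F`,
and both choices persist upwards, so the vertices choosing `x_i` form a saturated set. If all
vertices choose the same variable, the other one divides no minimal generator
(`apply_eq_zero_of_isMinimalGenerator`). Conversely, `separationIdeal` turns a saturated set and its
complement, both nonempty, into a separation (`isSeparation_separationIdeal`). -/

noncomputable section

/-! ### Monomial ideals and squarefree monomials -/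

section MonomialIdeal

variable {V K : Type*} [Field K]

/-- The exponent vector of the squarefree monomial with support `F`. -/
def squarefreeExponent (F : Finset V) : V →₀ ℕ := ∑ j ∈ F, Finsupp.single j 1

lemma squarefreeExponent_apply [DecidableEq V] (F : Finset V) (j : V) :
    squarefreeExponent F j = if j ∈ F then 1 else 0 := by
  simp [squarefreeExponent, Finsupp.finsetSum_apply, Finsupp.single_apply]

lemma support_squarefreeExponent (F : Finset V) : (squarefreeExponent F).support = F := by
  classical
  ext j
  simp [squarefreeExponent_apply]

lemma squarefreeExponent_support_le (a : V →₀ ℕ) : squarefreeExponent a.support ≤ a := by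
  classical
  intro j
  rw [squarefreeExponent_apply]
  split_ifs with h
  · exact Nat.one_le_iff_ne_zero.mpr (Finsupp.mem_support_iff.mp h)
  · exact Nat.zero_le _

lemma squarefreeExponent_mono {F G : Finset V} (h : F ⊆ G) :
    squarefreeExponent F ≤ squarefreeExponent G := by
  classical
  intro j
  rw [squarefreeExponent_apply, squarefreeExponent_apply]
  split_ifs with h₁ h₂
  · exact le_rfl
  · exact absurd (h h₁) h₂
  · exact Nat.zero_le _
  · exact le_rfl

lemma prod_X_eq_monomial (F : Finset V) :
    (∏ j ∈ F, X j : MvPolynomial V K) = monomial (squarefreeExponent F) 1 := by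
  rw [squarefreeExponent, monomial_sum_one]
  rfl

lemma monomial_mem_of_le {J : Ideal (MvPolynomial V K)} {a b : V →₀ ℕ} (hab : a ≤ b)
    (h : monomial a (1 : K) ∈ J) (r : K) : monomial b r ∈ J := by
  have := J.mul_mem_left (monomial (b - a) r) h
  rwa [monomial_mul, tsub_add_cancel_of_le hab, mul_one] at this

lemma monomial_mem_span_iff {A : Set (V →₀ ℕ)} {a : V →₀ ℕ} :
    monomial a (1 : K) ∈ Ideal.span ((fun b => monomial b (1 : K)) '' A) ↔ ∃ b ∈ A, b ≤ a := by
  classical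
  rw [mem_ideal_span_monomial_image, support_monomial, if_neg one_ne_zero]
  simp

lemma IsMonomialIdeal.mem_iff {J : Ideal (MvPolynomial V K)} (hJ : IsMonomialIdeal J)
    {f : MvPolynomial V K} : f ∈ J ↔ ∀ a ∈ f.support, monomial a (1 : K) ∈ J := by
  obtain ⟨A, rfl⟩ := hJ
  rw [mem_ideal_span_monomial_image]
  exact forall₂_congr fun a _ => monomial_mem_span_iff.symm

lemma IsMonomialIdeal.monomial_mem_of_coeff_ne_zero {J : Ideal (MvPolynomial V K)}
    (hJ : IsMonomialIdeal J) {f : MvPolynomial V K} (hf : f ∈ J) {a : V →₀ ℕ}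
    (ha : coeff a f ≠ 0) : monomial a (1 : K) ∈ J :=
  hJ.mem_iff.mp hf a (mem_support_iff.mpr ha)

lemma IsMonomialIdeal.induction {J : Ideal (MvPolynomial V K)} (hJ : IsMonomialIdeal J)
    {p : MvPolynomial V K → Prop} (zero : p 0) (add : ∀ f g, p f → p g → p (f + g))
    (mono : ∀ a r, monomial a (1 : K) ∈ J → p (monomial a r)) {f : MvPolynomial V K}
    (hf : f ∈ J) : p f := by
  rw [f.as_sum]
  exact Finset.sum_induction _ p add zero fun a ha => mono a _ (hJ.mem_iff.mp hf a ha)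

lemma exists_isMinimalGenerator_le {J : Ideal (MvPolynomial V K)} {a : V →₀ ℕ}
    (ha : monomial a (1 : K) ∈ J) : ∃ b, b ≤ a ∧ IsMinimalGenerator J b :=
  exists_minimal_le_of_wellFoundedLT (fun b => monomial b (1 : K) ∈ J) a ha

lemma mk_mem_nonZeroDivisors_iff {R : Type*} [CommRing R] {J : Ideal R} {x : R} :
    Ideal.Quotient.mk J x ∈ nonZeroDivisors (R ⧸ J) ↔ ∀ f, x * f ∈ J → f ∈ J := by
  rw [mem_nonZeroDivisors_iff_left]
  constructor
  · intro h f hf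
    exact Ideal.Quotient.eq_zero_iff_mem.mp
      (h _ (by rw [← map_mul]; exact Ideal.Quotient.eq_zero_iff_mem.mpr hf))
  · intro h q hq
    obtain ⟨f, rfl⟩ := Ideal.Quotient.mk_surjective q
    rw [← map_mul] at hq
    exact Ideal.Quotient.eq_zero_iff_mem.mpr (h f (Ideal.Quotient.eq_zero_iff_mem.mp hq))

lemma X_dvd_monomial_one_iff {v : V} {a : V →₀ ℕ} :
    (X v : MvPolynomial V K) ∣ monomial a 1 ↔ a v ≠ 0 := by
  rw [X_dvd_monomial]
  simp

end MonomialIdeal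

/-! ### Stanley–Reisner ideals and connectedness via saturated sets -/

namespace SimplicialCpx

variable {V : Type*} (K : Type*) [Field K] (Δ : SimplicialCpx V)

lemma stanleyReisnerIdeal_eq_span : Δ.stanleyReisnerIdeal K =
    Ideal.span ((fun a => monomial a (1 : K)) '' (squarefreeExponent '' {N | N ∉ Δ})) := by
  rw [stanleyReisnerIdeal]
  congr 1
  ext f
  simp only [prod_X_eq_monomial, Set.mem_ofPred_eq, Set.mem_image]
  constructor
  · rintro ⟨N, hN, rfl⟩
    exact ⟨_, ⟨N, hN, rfl⟩, rfl⟩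
  · rintro ⟨_, ⟨N, hN, rfl⟩, rfl⟩
    exact ⟨N, hN, rfl⟩

lemma isMonomialIdeal_stanleyReisnerIdeal : IsMonomialIdeal (Δ.stanleyReisnerIdeal K) :=
  ⟨_, Δ.stanleyReisnerIdeal_eq_span K⟩

variable {K Δ}

lemma monomial_mem_stanleyReisnerIdeal {a : V →₀ ℕ} :
    monomial a (1 : K) ∈ Δ.stanleyReisnerIdeal K ↔ a.support ∉ Δ := by
  rw [stanleyReisnerIdeal_eq_span, monomial_mem_span_iff]
  simp only [Set.exists_mem_image, Set.mem_ofPred_eq]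
  constructor
  · rintro ⟨N, hN, hle⟩ ha
    refine hN (Δ.lower ?_ ha)
    rw [← support_squarefreeExponent N]
    exact Finsupp.support_mono hle
  · exact fun h => ⟨_, h, squarefreeExponent_support_le a⟩

lemma coeff_eq_zero_of_mem {f : MvPolynomial V K} (hf : f ∈ Δ.stanleyReisnerIdeal K)
    {a : V →₀ ℕ} (ha : a.support ∈ Δ) : coeff a f = 0 := by
  by_contra h
  exact monomial_mem_stanleyReisnerIdeal.mp
    ((Δ.isMonomialIdeal_stanleyReisnerIdeal K).monomial_mem_of_coeff_ne_zero hf h) ha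

variable [DecidableEq V]

lemma mem_nonJoinable_singleton {i : V} {F : Finset V} :
    F ∈ Δ.nonJoinable {i} ↔ F ∈ Δ ∧ i ∉ F ∧ insert i F ∉ Δ := by
  rw [nonJoinable, Set.mem_ofPred_eq, Finset.disjoint_singleton_right, Finset.union_comm,
    ← Finset.insert_eq]

/-- `G_B(Δ)` is connected if and only if a set of faces that is saturated with respect to
inclusions within `N_B(Δ)` contains all or no vertices. -/
lemma preconnected_inclusionGraph_iff {B : Finset V} :
    (Δ.inclusionGraph B).Preconnected ↔ ∀ C : Set (Finset V),
      (∀ F ∈ Δ.nonJoinable B, ∀ G ∈ Δ.nonJoinable B, F ⊆ G → (F ∈ C ↔ G ∈ C)) →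
      ∀ F ∈ Δ.nonJoinable B, ∀ G ∈ Δ.nonJoinable B, F ∈ C → G ∈ C := by
  constructor
  · intro h C hC F hF G hG hFC
    obtain ⟨w⟩ := h ⟨F, hF⟩ ⟨G, hG⟩
    have key : ∀ u v : Δ.nonJoinable B, (Δ.inclusionGraph B).Walk u v → u.1 ∈ C → v.1 ∈ C := by
      intro u v w
      induction w with
      | nil => exact id
      | cons hadj _ ih =>
        intro hu
        refine ih ?_
        rcases hadj with h | h
        · exact (hC _ (Subtype.property _) _ (Subtype.property _) h.1).mp hu
        · exact (hC _ (Subtype.property _) _ (Subtype.property _) h.1).mpr hu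
    exact key _ _ w hFC
  · intro h u v
    -- The test set is the connected component of `u`.
    have := h {G | ∃ hG : G ∈ Δ.nonJoinable B, (Δ.inclusionGraph B).Reachable u ⟨G, hG⟩} ?_
      u.1 u.2 v.1 v.2 ⟨u.2, SimpleGraph.Reachable.refl u⟩
    · exact this.2
    · intro F hF G hG hFG
      rcases hFG.eq_or_ssubset with rfl | hss
      · rfl
      have hadj : (Δ.inclusionGraph B).Adj ⟨F, hF⟩ ⟨G, hG⟩ := Or.inl hss
      exact ⟨fun ⟨_, hr⟩ => ⟨hG, hr.trans hadj.reachable⟩,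
        fun ⟨_, hr⟩ => ⟨hF, hr.trans hadj.symm.reachable⟩⟩

end SimplicialCpx

/-! ### Homomorphisms of degree `-e_i` -/

section Component

variable {V K : Type*} [Field K] {I : Ideal (MvPolynomial V K)} {i : V}

/-- The clause for `a i = 0` is needed separately: truncated subtraction then returns `a` itself,
whereas the true degree has a negative entry and its component is zero. -/
lemma mem_quotientComponent_sub_single [DecidableEq V] {a : V →₀ ℕ} {q : MvPolynomial V K ⧸ I}
    (hq : q ∈ quotientComponent I fun j => (a j : ℤ) + (-(Pi.single i 1 : V → ℤ)) j) :
    (a i = 0 → q = 0) ∧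
      ∃ c : K, q = Ideal.Quotient.mk I (monomial (a - Finsupp.single i 1) c) := by
  have key : ∀ b : V →₀ ℕ, (∀ j, (b j : ℤ) = (a j : ℤ) + (-(Pi.single i 1 : V → ℤ)) j) →
      a i ≠ 0 ∧ b = a - Finsupp.single i 1 := by
    intro b hb
    have hi := hb i
    rw [Pi.neg_apply, Pi.single_eq_same] at hi
    refine ⟨by omega, Finsupp.ext fun j => ?_⟩
    have hj := hb j
    rw [Finsupp.tsub_apply]
    by_cases hji : j = i
    · subst hji
      rw [Finsupp.single_eq_same]
      omega
    · rw [Pi.neg_apply, Pi.single_eq_of_ne hji] at hj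
      rw [Finsupp.single_eq_of_ne hji]
      omega
  induction hq using Submodule.span_induction with
  | mem q hq =>
    obtain ⟨b, hb, rfl⟩ := hq
    obtain ⟨h0, rfl⟩ := key b hb
    exact ⟨fun h => absurd h h0, 1, rfl⟩
  | zero => exact ⟨fun _ => rfl, 0, by simp⟩
  | add p q _ _ hp hq =>
    obtain ⟨hp, c, hc⟩ := hp
    obtain ⟨hq, d, hd⟩ := hq
    exact ⟨fun h => by rw [hp h, hq h, add_zero], c + d, by rw [hc, hd, ← map_add, ← map_add]⟩
  | smul r q _ hq =>
    obtain ⟨hq, c, hc⟩ := hq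
    refine ⟨fun h => by rw [hq h, smul_zero], r * c, ?_⟩
    rw [hc, ← smul_eq_mul, ← smul_monomial]
    rfl

lemma cotangentT1Component_eq_bot_iff {c : V → ℤ} :
    cotangentT1Component I c = ⊥ ↔
      ∀ φ ∈ homComponent I c, φ ∈ LinearMap.range (deltaStar I) := by
  rw [cotangentT1Component, eq_bot_iff, Submodule.map_le_iff_le_comap]
  refine forall₂_congr fun φ _ => ?_
  rw [Submodule.mem_comap, Submodule.mem_bot, LinearMap.restrictScalars_apply,
    Submodule.mkQ_apply, Submodule.Quotient.mk_eq_zero]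

lemma deltaStar_C_smul_pderiv_apply (c : K) (f : I) :
    deltaStar I ((C c : MvPolynomial V K) • pderiv i) f =
      Ideal.Quotient.mk I (C c * pderiv i (f : MvPolynomial V K)) :=
  rfl

lemma IsMonomialIdeal.linearMap_ext (hI : IsMonomialIdeal I)
    {φ ψ : I →ₗ[MvPolynomial V K] MvPolynomial V K ⧸ I}
    (h : ∀ a (ha : monomial a (1 : K) ∈ I), φ ⟨_, ha⟩ = ψ ⟨_, ha⟩) : φ = ψ := by
  refine LinearMap.ext fun f => ?_
  have key : ∃ hf : (f : MvPolynomial V K) ∈ I, φ ⟨f, hf⟩ = ψ ⟨f, hf⟩ := by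
    refine hI.induction (p := fun g => ∃ hg : g ∈ I, φ ⟨g, hg⟩ = ψ ⟨g, hg⟩) ?_ ?_ ?_ f.2
    · exact ⟨I.zero_mem, (map_zero φ).trans (map_zero ψ).symm⟩
    · rintro g g' ⟨hg, h₁⟩ ⟨hg', h₂⟩
      refine ⟨I.add_mem hg hg', ?_⟩
      have := congrArg₂ (· + ·) h₁ h₂
      rwa [← map_add, ← map_add] at this
    · intro a r ha
      have e : (monomial a r : MvPolynomial V K) = C r * monomial a 1 := by
        rw [C_mul_monomial, mul_one]
      refine ⟨e ▸ I.mul_mem_left _ ha, ?_⟩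
      have := congrArg ((C r : MvPolynomial V K) • ·) (h a ha)
      simp only [← map_smul] at this
      convert this <;> exact e
  exact key.2

end Component

/-! ### Vanishing of `T¹` in degree `-e_i` and connectedness -/

namespace SimplicialCpx

variable {V K : Type*} [Field K] [DecidableEq V] {Δ : SimplicialCpx V} {i : V}

lemma erase_support_mem_nonJoinable {a : V →₀ ℕ} (ha : a.support ∉ Δ)
    (h : a.support.erase i ∈ Δ) : a i ≠ 0 ∧ a.support.erase i ∈ Δ.nonJoinable {i} := by
  have hi : i ∈ a.support := by
    by_contra hi
    rw [Finset.erase_eq_of_notMem hi] at h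
    exact ha h
  refine ⟨Finsupp.mem_support_iff.mp hi, mem_nonJoinable_singleton.mpr
    ⟨h, Finset.notMem_erase _ _, ?_⟩⟩
  rwa [Finset.insert_erase hi]

/-- If `x_i²` divided `x^a`, dividing by `x_i` would keep the support, a non-face. Hence the factor
`a i` produced by `∂/∂x_i` is 1 wherever it matters, and the characteristic of `K` plays no role. -/
lemma eq_one_of_support_sub_single_mem {a : V →₀ ℕ} (ha : a.support ∉ Δ)
    (h : (a - Finsupp.single i 1).support ∈ Δ) :
    a i = 1 ∧ a.support.erase i ∈ Δ.nonJoinable {i} := by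
  have hsub : a.support.erase i ⊆ (a - Finsupp.single i 1).support := by
    intro j hj
    obtain ⟨hji, hj⟩ := Finset.mem_erase.mp hj
    rw [Finsupp.mem_support_iff] at hj ⊢
    rwa [Finsupp.tsub_apply, Finsupp.single_eq_of_ne hji, tsub_zero]
  obtain ⟨h0, hN⟩ := erase_support_mem_nonJoinable ha (Δ.lower hsub h)
  refine ⟨?_, hN⟩
  by_contra h1
  refine ha (Δ.lower ?_ h)
  intro j hj
  by_cases hji : j = i
  · subst hji
    rw [Finsupp.mem_support_iff, Finsupp.tsub_apply, Finsupp.single_eq_same]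
    omega
  · exact hsub (Finset.mem_erase.mpr ⟨hji, hj⟩)

lemma support_add_single (F : Finset V) (i : V) :
    (squarefreeExponent F + Finsupp.single i 1).support = insert i F := by
  ext j
  simp only [Finsupp.mem_support_iff, Finsupp.add_apply, squarefreeExponent_apply,
    Finsupp.single_apply, Finset.mem_insert]
  split_ifs <;> simp_all [eq_comm]

lemma monomial_mem_of_mem_nonJoinable {F : Finset V} (hF : F ∈ Δ.nonJoinable {i}) :
    monomial (squarefreeExponent F + Finsupp.single i 1) (1 : K) ∈ Δ.stanleyReisnerIdeal K := by
  rw [monomial_mem_stanleyReisnerIdeal, support_add_single]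
  exact (mem_nonJoinable_singleton.mp hF).2.2

lemma homComponent_le_range_of_preconnected
    (h : (Δ.inclusionGraph {i}).Preconnected) :
    ∀ φ ∈ homComponent (Δ.stanleyReisnerIdeal K) (-(Pi.single i 1 : V → ℤ)),
      φ ∈ LinearMap.range (deltaStar (Δ.stanleyReisnerIdeal K)) := by
  set I := Δ.stanleyReisnerIdeal K
  intro φ hφ
  have hlam : ∀ a (ha : monomial a (1 : K) ∈ I), (a i = 0 → φ ⟨_, ha⟩ = 0) ∧
      ∃ c : K, φ ⟨_, ha⟩ = Ideal.Quotient.mk I (monomial (a - Finsupp.single i 1) c) :=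
    fun a ha => mem_quotientComponent_sub_single (hφ a 1 ha)
  have hmul : ∀ a b (ha : monomial a (1 : K) ∈ I) (hb : monomial b (1 : K) ∈ I), a ≤ b →
      a i ≠ 0 → ∀ c : K, φ ⟨_, ha⟩ = Ideal.Quotient.mk I (monomial (a - Finsupp.single i 1) c) →
      φ ⟨_, hb⟩ = Ideal.Quotient.mk I (monomial (b - Finsupp.single i 1) c) := by
    intro a b ha hb hab hai c hc
    have e : (⟨_, hb⟩ : I) = (monomial (b - a) (1 : K)) • (⟨_, ha⟩ : I) := by
      apply Subtype.ext
      simp [monomial_mul, tsub_add_cancel_of_le hab]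
    have hle : Finsupp.single i 1 ≤ a := by
      rw [Finsupp.single_le_iff]
      omega
    have hs : ∀ s f : MvPolynomial V K,
        s • Ideal.Quotient.mk I f = Ideal.Quotient.mk I (s * f) := fun _ _ => rfl
    rw [e, map_smul, hc, hs, monomial_mul, one_mul, ← add_tsub_assoc_of_le hle, tsub_add_cancel_of_le hab]
  -- `S c` is the set of vertices on which `φ` takes the value `c`.
  let S : K → Set (Finset V) := fun c => {F | ∃ hF : F ∈ Δ.nonJoinable {i},
    φ ⟨_, monomial_mem_of_mem_nonJoinable hF⟩ =
      Ideal.Quotient.mk I (monomial (squarefreeExponent F) c)}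
  have hsat : ∀ F ∈ Δ.nonJoinable {i}, ∃ c, F ∈ S c := by
    intro F hF
    obtain ⟨c, hc⟩ := (hlam _ (monomial_mem_of_mem_nonJoinable hF)).2
    exact ⟨c, hF, by rw [hc, add_tsub_cancel_right]⟩
  have hup : ∀ c, ∀ F ∈ S c, ∀ G ∈ Δ.nonJoinable {i}, F ⊆ G → G ∈ S c := by
    rintro c F ⟨hF, hc⟩ G hG hFG
    refine ⟨hG, ?_⟩
    rw [hmul _ _ (monomial_mem_of_mem_nonJoinable hF) (monomial_mem_of_mem_nonJoinable hG)
      (by gcongr; exact squarefreeExponent_mono hFG) (by simp) c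
      (by rw [hc, add_tsub_cancel_right]), add_tsub_cancel_right]
  -- `x_F` is nonzero modulo `I`, so its scalar is determined.
  have huniq : ∀ c d F, F ∈ S c → F ∈ S d → c = d := by
    rintro c d F ⟨hF, hc⟩ ⟨_, hd⟩
    have := coeff_eq_zero_of_mem (Ideal.Quotient.eq.mp (hc.symm.trans hd))
      (a := squarefreeExponent F)
      (by rw [support_squarefreeExponent]; exact (mem_nonJoinable_singleton.mp hF).1)
    simpa [sub_eq_zero] using this
  obtain ⟨c, hc⟩ : ∃ c, ∀ F ∈ Δ.nonJoinable {i}, F ∈ S c := by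
    by_cases hne : ∃ F₀, F₀ ∈ Δ.nonJoinable {i}
    · obtain ⟨F₀, hF₀⟩ := hne
      obtain ⟨c, hc⟩ := hsat F₀ hF₀
      refine ⟨c, fun F hF => preconnected_inclusionGraph_iff.mp h (S c) ?_ F₀ hF₀ F hF hc⟩
      intro F hF G hG hFG
      refine ⟨fun hFc => hup c F hFc G hG hFG, fun hGc => ?_⟩
      -- Downward saturation: `F` has some value, which propagates up to `G` and must agree with the
      -- value there.
      obtain ⟨d, hd⟩ := hsat F hF
      rwa [huniq c d G hGc (hup d F hd G hG hFG)]
    · exact ⟨0, fun F hF => (hne ⟨F, hF⟩).elim⟩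
  refine ⟨(C c : MvPolynomial V K) • pderiv i,
    (Δ.isMonomialIdeal_stanleyReisnerIdeal K).linearMap_ext fun a ha => ?_⟩
  rw [deltaStar_C_smul_pderiv_apply, pderiv_monomial, C_mul_monomial, one_mul]
  have haΔ := monomial_mem_stanleyReisnerIdeal.mp ha
  by_cases h0 : a i = 0
  · rw [(hlam a ha).1 h0, h0, Nat.cast_zero, mul_zero, monomial_zero, map_zero]
  -- If `x^{a-e_i}` is nonzero modulo `I`, then `x^a` is a multiple of `x_i x_F` for the vertex `F =
  -- supp a \ {i}`; otherwise both sides vanish.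
  by_cases hf : (a - Finsupp.single i 1).support ∈ Δ
  · obtain ⟨h1, hN⟩ := eq_one_of_support_sub_single_mem haΔ hf
    obtain ⟨_, hc⟩ := hc _ hN
    rw [h1, Nat.cast_one, mul_one]
    refine (hmul _ _ (monomial_mem_of_mem_nonJoinable hN) ha ?_ (by simp) c ?_).symm
    · intro j
      have := squarefreeExponent_support_le a j
      rw [squarefreeExponent_apply] at this
      rw [Finsupp.add_apply, squarefreeExponent_apply, Finsupp.single_apply]
      by_cases hji : j = i
      · subst hji
        simp [h1]
      · simpa [hji, Ne.symm hji] using this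
    · rw [hc, add_tsub_cancel_right]
  · have hz : ∀ r : K, Ideal.Quotient.mk I (monomial (a - Finsupp.single i 1) r) = 0 := fun r =>
      Ideal.Quotient.eq_zero_iff_mem.mpr
        (monomial_mem_of_le le_rfl (monomial_mem_stanleyReisnerIdeal.mpr hf) r)
    obtain ⟨d, hd⟩ := (hlam a ha).2
    rw [hd, hz, hz]

/-- The linear endomorphism of the polynomial ring that divides a monomial `x_i x^m` with
`i ∉ supp m ∈ C` by `x_i` and sends all other monomials to zero. -/
def divOn (K : Type*) [Field K] (i : V) (C : Set (Finset V)) :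
    MvPolynomial V K →ₗ[K] MvPolynomial V K :=
  open Classical in
  (basisMonomials V K).constr K fun a =>
    if a i = 1 ∧ a.support.erase i ∈ C then monomial (a - Finsupp.single i 1) 1 else 0

open Classical in
lemma divOn_monomial (C : Set (Finset V)) (a : V →₀ ℕ) (r : K) :
    divOn K i C (monomial a r) =
      if a i = 1 ∧ a.support.erase i ∈ C then monomial (a - Finsupp.single i 1) r else 0 := by
  have : (monomial a r : MvPolynomial V K) = r • basisMonomials V K a := by
    rw [coe_basisMonomials, smul_monomial, smul_eq_mul, mul_one]
  rw [this, map_smul, divOn, Module.Basis.constr_basis, smul_ite, smul_zero, smul_monomial,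
    smul_eq_mul, mul_one]

/-- Saturation of `C` is what makes the `K`-linear map `divOn` linear over the polynomial ring
modulo `I`. -/
lemma divOn_mul_sub_mem {C : Set (Finset V)}
    (hC : ∀ F ∈ Δ.nonJoinable {i}, ∀ G ∈ Δ.nonJoinable {i}, F ⊆ G → (F ∈ C ↔ G ∈ C))
    (hCN : C ⊆ Δ.nonJoinable {i}) (s : MvPolynomial V K) {f : MvPolynomial V K}
    (hf : f ∈ Δ.stanleyReisnerIdeal K) :
    divOn K i C (s * f) - s * divOn K i C f ∈ Δ.stanleyReisnerIdeal K := by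
  set I := Δ.stanleyReisnerIdeal K
  refine (Δ.isMonomialIdeal_stanleyReisnerIdeal K).induction
    (p := fun f => divOn K i C (s * f) - s * divOn K i C f ∈ I) (by simp) ?_ ?_ hf
  · intro f g hf hg
    have := I.add_mem hf hg
    rw [mul_add, map_add, map_add]
    convert this using 1
    ring
  intro a r ha
  rw [monomial_mem_stanleyReisnerIdeal] at ha
  induction s using MvPolynomial.induction_on' with
  | add p q hp hq =>
    have := I.add_mem hp hq
    rw [add_mul, map_add]
    convert this using 1
    ring
  | monomial b t =>
    rw [monomial_mul, divOn_monomial, divOn_monomial]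
    have hsub : a.support.erase i ⊆ (b + a).support.erase i :=
      Finset.erase_subset_erase _ (Finsupp.support_mono le_add_self)
    have hab : (b + a).support ∉ Δ := fun h => ha (Δ.lower (Finsupp.support_mono le_add_self) h)
    split_ifs with h₁ h₂ h₂
    · have hle : Finsupp.single i 1 ≤ a := by
        rw [Finsupp.single_le_iff]
        omega
      rw [monomial_mul, add_tsub_assoc_of_le hle, sub_self]
      exact I.zero_mem
    -- The support of `a` without `i` lies below a vertex, hence is a face and itself a vertex, so
    -- saturation places it in `C`.
    · exfalso
      have hN := hCN h₁.2
      have hF := erase_support_mem_nonJoinable ha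
        (Δ.lower hsub (mem_nonJoinable_singleton.mp hN).1)
      have h1 := h₁.1
      rw [Finsupp.add_apply] at h1
      exact h₂ ⟨by have := hF.1; omega, (hC _ hF.2 _ hN hsub).mpr h₁.2⟩
    · have hle : Finsupp.single i 1 ≤ a := by
        rw [Finsupp.single_le_iff]
        omega
      rw [monomial_mul, zero_sub, neg_mem_iff, ← add_tsub_assoc_of_le hle]
      -- If the leftover monomial were outside `I`, the support of the product without `i` would be
      -- a vertex above one in `C`, hence in `C`.
      refine monomial_mem_of_le le_rfl (monomial_mem_stanleyReisnerIdeal.mpr fun hf => h₁ ?_) _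
      obtain ⟨h1, hN⟩ := eq_one_of_support_sub_single_mem hab hf
      exact ⟨h1, (hC _ (hCN h₂.2) _ hN hsub).mp h₂.2⟩
    · rw [mul_zero, sub_zero]
      exact I.zero_mem

/-- The homomorphism `I_Δ → S/I_Δ` of degree `-e_i` attached to a saturated set of vertices of
`G_{i}(Δ)`. -/
def divOnHom (K : Type*) [Field K] {C : Set (Finset V)}
    (hC : ∀ F ∈ Δ.nonJoinable {i}, ∀ G ∈ Δ.nonJoinable {i}, F ⊆ G → (F ∈ C ↔ G ∈ C))
    (hCN : C ⊆ Δ.nonJoinable {i}) :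
    Δ.stanleyReisnerIdeal K →ₗ[MvPolynomial V K]
      MvPolynomial V K ⧸ Δ.stanleyReisnerIdeal K where
  toFun f := Ideal.Quotient.mk _ (divOn K i C f)
  map_add' f g := by simp
  map_smul' s f := Ideal.Quotient.eq.mpr (divOn_mul_sub_mem hC hCN s f.2)

lemma divOnHom_apply {C : Set (Finset V)}
    (hC : ∀ F ∈ Δ.nonJoinable {i}, ∀ G ∈ Δ.nonJoinable {i}, F ⊆ G → (F ∈ C ↔ G ∈ C))
    (hCN : C ⊆ Δ.nonJoinable {i}) (f : Δ.stanleyReisnerIdeal K) :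
    divOnHom K hC hCN f = Ideal.Quotient.mk _ (divOn K i C f) :=
  rfl

lemma divOnHom_mem_homComponent {C : Set (Finset V)}
    (hC : ∀ F ∈ Δ.nonJoinable {i}, ∀ G ∈ Δ.nonJoinable {i}, F ⊆ G → (F ∈ C ↔ G ∈ C))
    (hCN : C ⊆ Δ.nonJoinable {i}) :
    divOnHom K hC hCN ∈
      homComponent (Δ.stanleyReisnerIdeal K) (-(Pi.single i 1 : V → ℤ)) := by
  intro a r ha
  rw [divOnHom_apply, divOn_monomial]
  split_ifs with h
  · have : Ideal.Quotient.mk (Δ.stanleyReisnerIdeal K) (monomial (a - Finsupp.single i 1) r) =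
        r • Ideal.Quotient.mk (Δ.stanleyReisnerIdeal K)
          (monomial (a - Finsupp.single i 1) 1) := by
      rw [← mul_one r, ← smul_eq_mul, ← smul_monomial, smul_eq_mul, mul_one]
      rfl
    rw [this]
    refine Submodule.smul_mem _ _ (Submodule.subset_span ⟨_, fun j => ?_, rfl⟩)
    change ((a - Finsupp.single i 1 : V →₀ ℕ) j : ℤ) = a j + -(Pi.single i 1 : V → ℤ) j
    rw [Finsupp.tsub_apply]
    by_cases hji : j = i
    · subst hji
      simp [h.1]
    · simp [hji]
  · rw [map_zero]
    exact Submodule.zero_mem _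

/-- In the Leibniz expansion of `D (x^m x_i)` the term `x_i D(x^m)` is divisible by `x_i`, so it
contributes nothing at `x^m`. The point is that the value is independent of `m`. -/
lemma coeff_derivation_monomial_add_single
    (D : Derivation K (MvPolynomial V K) (MvPolynomial V K)) {m : V →₀ ℕ} (hm : m i = 0) :
    coeff m (D (monomial (m + Finsupp.single i 1) 1)) = coeff 0 (D (X i)) := by
  have : (monomial (m + Finsupp.single i 1) 1 : MvPolynomial V K) = monomial m 1 * X i := by
    rw [X, monomial_mul, mul_one]
  have h₁ : D (monomial m 1 * X i) = monomial m 1 * D (X i) + X i * D (monomial m 1) :=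
    D.leibniz _ _
  have h₂ : i ∉ m.support := Finsupp.notMem_support_iff.mpr hm
  have h₃ := coeff_monomial_mul 0 m 1 (D (X i))
  rw [add_zero, one_mul] at h₃
  rw [this, h₁, coeff_add, coeff_X_mul', if_neg h₂, add_zero, h₃]

lemma preconnected_of_homComponent_le_range
    (h : ∀ φ ∈ homComponent (Δ.stanleyReisnerIdeal K) (-(Pi.single i 1 : V → ℤ)),
      φ ∈ LinearMap.range (deltaStar (Δ.stanleyReisnerIdeal K))) :
    (Δ.inclusionGraph {i}).Preconnected := by
  rw [preconnected_inclusionGraph_iff]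
  intro C hC F hF G hG hFC
  by_contra hGC
  -- Cutting `C` down to vertices keeps it saturated and makes `divOnHom` applicable.
  have hC' : ∀ F ∈ Δ.nonJoinable {i}, ∀ G ∈ Δ.nonJoinable {i}, F ⊆ G →
      (F ∈ C ∩ Δ.nonJoinable {i} ↔ G ∈ C ∩ Δ.nonJoinable {i}) := fun F hF G hG hFG =>
    and_congr (hC F hF G hG hFG) (iff_of_true hF hG)
  obtain ⟨D, hD⟩ := h _ (divOnHom_mem_homComponent (K := K) hC' Set.inter_subset_right)
  have key : ∀ H (hH : H ∈ Δ.nonJoinable {i}),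
      coeff (squarefreeExponent H) (divOn K i (C ∩ Δ.nonJoinable {i})
        (monomial (squarefreeExponent H + Finsupp.single i 1) 1)) = coeff 0 (D (X i)) := by
    intro H hH
    obtain ⟨hHΔ, hiH, _⟩ := mem_nonJoinable_singleton.mp hH
    have := LinearMap.congr_fun hD ⟨_, monomial_mem_of_mem_nonJoinable hH⟩
    rw [← coeff_derivation_monomial_add_single D (m := squarefreeExponent H)
      (by rw [squarefreeExponent_apply, if_neg hiH])]
    have := coeff_eq_zero_of_mem (Ideal.Quotient.eq.mp this) (a := squarefreeExponent H)
      (by rwa [support_squarefreeExponent])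
    rw [coeff_sub, sub_eq_zero] at this
    exact this.symm
  have val : ∀ H, i ∉ H → (squarefreeExponent H + Finsupp.single i 1 : V →₀ ℕ) i = 1 ∧
      (squarefreeExponent H + Finsupp.single i 1 : V →₀ ℕ).support.erase i = H := by
    intro H hH
    rw [support_add_single, Finset.erase_insert hH, Finsupp.add_apply, squarefreeExponent_apply,
      if_neg hH, Finsupp.single_eq_same]
    exact ⟨rfl, rfl⟩
  have hF' := key F hF
  have hG' := key G hG
  obtain ⟨h₁, h₂⟩ := val F (mem_nonJoinable_singleton.mp hF).2.1
  obtain ⟨h₃, h₄⟩ := val G (mem_nonJoinable_singleton.mp hG).2.1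
  rw [divOn_monomial, h₁, h₂, if_pos ⟨rfl, hFC, hF⟩, add_tsub_cancel_right, coeff_monomial,
    if_pos rfl] at hF'
  rw [divOn_monomial, h₃, h₄, if_neg fun h => hGC h.2.1, coeff_zero] at hG'
  exact one_ne_zero (hF'.trans hG'.symm)

theorem preconnected_iff_cotangentT1Component_eq_bot :
    (Δ.inclusionGraph {i}).Preconnected ↔
      cotangentT1Component (Δ.stanleyReisnerIdeal K) (-(Pi.single i 1 : V → ℤ)) = ⊥ := by
  rw [cotangentT1Component_eq_bot_iff]
  exact ⟨homComponent_le_range_of_preconnected, preconnected_of_homComponent_le_range⟩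

end SimplicialCpx

/-! ### Exponent vectors under `y ↦ x_i` -/

section Specialization

variable {V K : Type*} [Field K] {i : V}

lemma specializeY_eq_rename (i : V) :
    (specializeY i : MvPolynomial (Option V) K →ₐ[K] MvPolynomial V K) =
      rename fun o => o.elim i id := by
  rw [specializeY, rename_eq_aeval]
  congr 1
  funext o
  cases o <;> rfl

/-- The exponent of the image of a monomial of exponent `a` under `specializeY i`. -/
def specializeExponent (i : V) (a : Option V →₀ ℕ) : V →₀ ℕ :=
  a.mapDomain fun o => o.elim i id

lemma specializeY_monomial (i : V) (a : Option V →₀ ℕ) (r : K) :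
    specializeY i (monomial a r) = monomial (specializeExponent i a) r := by
  rw [specializeY_eq_rename, rename_monomial, specializeExponent]

/-- The exponent vector in `S[y]` of the squarefree monomial `x_F`. -/
def liftExponent (F : Finset V) : Option V →₀ ℕ := squarefreeExponent (F.map .some)

lemma liftExponent_none (F : Finset V) : liftExponent F none = 0 := by
  classical
  rw [liftExponent, squarefreeExponent_apply, if_neg (by simp)]

lemma liftExponent_mono {F G : Finset V} (h : F ⊆ G) : liftExponent F ≤ liftExponent G :=
  squarefreeExponent_mono (Finset.map_subset_map.mpr h)

variable [DecidableEq V]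

lemma specializeExponent_apply (a : Option V →₀ ℕ) (j : V) :
    specializeExponent i a j = a (some j) + if j = i then a none else 0 := by
  induction a using Finsupp.induction_linear with
  | zero => simp [specializeExponent]
  | add a b ha hb =>
    rw [specializeExponent, Finsupp.mapDomain_add, Finsupp.add_apply]
    rw [specializeExponent] at ha hb
    rw [ha, hb, Finsupp.add_apply, Finsupp.add_apply]
    split_ifs <;> omega
  | single o n =>
    rw [specializeExponent, Finsupp.mapDomain_single]
    cases o with
    | none => by_cases h : j = i <;> simp [h]
    | some k => by_cases h : j = k <;> simp [h]

/-- The support of an exponent vector of `S[y]`, without the variables `y` and `x_i`. -/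
def restSupport (i : V) (a : Option V →₀ ℕ) : Finset V := a.support.eraseNone.erase i

lemma mem_restSupport {a : Option V →₀ ℕ} {j : V} :
    j ∈ restSupport i a ↔ j ≠ i ∧ a (some j) ≠ 0 := by
  rw [restSupport, Finset.mem_erase, Finset.mem_eraseNone, Finsupp.mem_support_iff]

lemma notMem_restSupport (a : Option V →₀ ℕ) : i ∉ restSupport i a :=
  fun h => (mem_restSupport.mp h).1 rfl

lemma restSupport_congr {a b : Option V →₀ ℕ} (h : ∀ j, j ≠ i → a (some j) = b (some j)) :
    restSupport i a = restSupport i b := by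
  ext j
  rw [mem_restSupport, mem_restSupport]
  exact and_congr_right fun hj => by rw [h j hj]

lemma restSupport_mono {a b : Option V →₀ ℕ} (h : a ≤ b) :
    restSupport i a ⊆ restSupport i b := by
  intro j
  rw [mem_restSupport, mem_restSupport]
  have := h (some j)
  exact fun hj => ⟨hj.1, by omega⟩

lemma restSupport_subset_support (a : Option V →₀ ℕ) :
    restSupport i a ⊆ (specializeExponent i a).support := by
  intro j hj
  rw [Finsupp.mem_support_iff, specializeExponent_apply]
  have := (mem_restSupport.mp hj).2
  omega

lemma support_specializeExponent_subset (a : Option V →₀ ℕ) :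
    (specializeExponent i a).support ⊆ insert i (restSupport i a) := by
  intro j hj
  rw [Finsupp.mem_support_iff, specializeExponent_apply] at hj
  by_cases hji : j = i
  · exact Finset.mem_insert.mpr (Or.inl hji)
  · rw [if_neg hji, add_zero] at hj
    exact Finset.mem_insert_of_mem (mem_restSupport.mpr ⟨hji, hj⟩)

lemma mem_support_specializeExponent {a : Option V →₀ ℕ} (h : a none ≠ 0 ∨ a (some i) ≠ 0) :
    i ∈ (specializeExponent i a).support := by
  rw [Finsupp.mem_support_iff, specializeExponent_apply, if_pos rfl]
  omega

lemma liftExponent_some (F : Finset V) (j : V) :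
    liftExponent F (some j) = if j ∈ F then 1 else 0 := by
  rw [liftExponent, squarefreeExponent_apply]
  simp

lemma restSupport_liftExponent_add {F : Finset V} (hF : i ∉ F) {o : Option V}
    (ho : o = none ∨ o = some i) :
    restSupport i (liftExponent F + Finsupp.single o 1) = F := by
  ext j
  rw [mem_restSupport, Finsupp.add_apply, liftExponent_some]
  constructor
  · rintro ⟨hj, h⟩
    rw [Finsupp.single_eq_of_ne (by rcases ho with rfl | rfl <;> simp [hj])] at h
    by_contra hjF
    simp [hjF] at h
  · intro hj
    exact ⟨fun h => hF (h ▸ hj), by simp [hj]⟩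

lemma liftExponent_restSupport_le (a : Option V →₀ ℕ) :
    liftExponent (restSupport i a) ≤ a := by
  rintro (_ | j)
  · rw [liftExponent_none]
    exact Nat.zero_le _
  · rw [liftExponent_some]
    split_ifs with h
    · exact Nat.one_le_iff_ne_zero.mpr (mem_restSupport.mp h).2
    · exact Nat.zero_le _

end Specialization

/-! ### Multiplication by a difference of two variables -/

section NonZeroDivisor

variable {W K : Type*} [Field K] {J : Ideal (MvPolynomial W K)} {u v : W}

lemma monomial_mem_of_sub_nonZeroDivisor
    (hJ : ∀ f, (X u - X v) * f ∈ J → f ∈ J) {a : W →₀ ℕ}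
    (hu : monomial (a + Finsupp.single u 1) (1 : K) ∈ J)
    (hv : monomial (a + Finsupp.single v 1) (1 : K) ∈ J) : monomial a (1 : K) ∈ J := by
  refine hJ _ ?_
  have e : (X u - X v) * monomial a (1 : K) =
      monomial (a + Finsupp.single u 1) 1 - monomial (a + Finsupp.single v 1) 1 := by
    rw [sub_mul, X, X, monomial_mul, monomial_mul, mul_one, add_comm a, add_comm a]
  rw [e]
  exact J.sub_mem hu hv

/-- At the monomial `x^a u`, which is outside `J`, the product `(u - v) f` has coefficient `coeff a
f - coeff (a + u - v) f`, the second term being absent if `v` does not divide `x^a`. It must vanish,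
and the shifted exponent has smaller `v`-degree, so induction on `a v` applies. -/
lemma IsMonomialIdeal.coeff_eq_zero_of_sub_mul_mem (hJ : IsMonomialIdeal J)
    {f : MvPolynomial W K} (hf : (X u - X v) * f ∈ J) (P : (W →₀ ℕ) → Prop)
    (hPu : ∀ a, P a → monomial (a + Finsupp.single u 1) (1 : K) ∉ J)
    (hPv : ∀ a, P a → P (a + Finsupp.single u 1 - Finsupp.single v 1) ∨ a v = 0)
    (huv : u ≠ v) : ∀ a, P a → coeff a f = 0 := by
  classical
  suffices ∀ n a, a v = n → P a → coeff a f = 0 from fun a => this _ a rfl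
  intro n
  induction n with
  | zero =>
    intro a ha hPa
    by_contra h
    refine hPu a hPa (hJ.monomial_mem_of_coeff_ne_zero hf ?_)
    rw [sub_mul, coeff_sub, add_comm, coeff_X_mul, coeff_X_mul',
      if_neg (by simp [ha, huv.symm]), sub_zero]
    exact h
  | succ n ih =>
    intro a ha hPa
    by_contra h
    refine hPu a hPa (hJ.monomial_mem_of_coeff_ne_zero hf ?_)
    have h0 : coeff (a + Finsupp.single u 1 - Finsupp.single v 1) f = 0 := by
      refine ih _ ?_ ((hPv a hPa).resolve_right (by omega))
      simp [huv.symm, ha]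
    rw [sub_mul, coeff_sub, coeff_X_mul' _ v, if_pos (by simp [ha, huv.symm]), h0, sub_zero,
      add_comm, coeff_X_mul]
    exact h

end NonZeroDivisor

/-! ### Every separation disconnects the graph -/

section SeparationCriterion

variable {V K : Type*} [Field K] {Δ : SimplicialCpx V} {i : V}
  {J : Ideal (MvPolynomial (Option V) K)}

open SimplicialCpx

namespace IsSeparation

lemma support_notMem (hJ : IsSeparation (Δ.stanleyReisnerIdeal K) i J) {a : Option V →₀ ℕ}
    (ha : monomial a (1 : K) ∈ J) : (specializeExponent i a).support ∉ Δ := by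
  rw [← monomial_mem_stanleyReisnerIdeal (K := K), ← specializeY_monomial, ← SetLike.mem_coe,
    ← hJ.image_eq]
  exact ⟨_, ha, rfl⟩

/-- A preimage of `x^b` in `J` may have terms that cancel, but some term maps onto `x^b`, and each
term lies in the monomial ideal `J`. -/
lemma exists_lift (hJ : IsSeparation (Δ.stanleyReisnerIdeal K) i J) {b : V →₀ ℕ}
    (hb : b.support ∉ Δ) : ∃ a, monomial a (1 : K) ∈ J ∧ specializeExponent i a = b := by
  have := monomial_mem_stanleyReisnerIdeal (K := K).mpr hb
  rw [← SetLike.mem_coe, ← hJ.image_eq] at this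
  obtain ⟨f, hf, hfb⟩ := this
  rw [specializeY_eq_rename] at hfb
  classical
  obtain ⟨a, ha, haf⟩ := coeff_rename_ne_zero (fun o : Option V => o.elim i id) f b
    (by rw [hfb, coeff_monomial, if_pos rfl]; exact one_ne_zero)
  exact ⟨a, hJ.isMonomialIdeal.monomial_mem_of_coeff_ne_zero hf haf, ha⟩

lemma mem_of_sub_mul_mem (hJ : IsSeparation (Δ.stanleyReisnerIdeal K) i J)
    {f : MvPolynomial (Option V) K} (hf : (X none - X (some i)) * f ∈ J) : f ∈ J :=
  mk_mem_nonZeroDivisors_iff.mp hJ.nonZeroDivisor f hf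

variable [DecidableEq V]

lemma liftExponent_mem (hJ : IsSeparation (Δ.stanleyReisnerIdeal K) i J) {F : Finset V}
    (hiF : i ∉ F) (hF : F ∉ Δ) : monomial (liftExponent F) (1 : K) ∈ J := by
  obtain ⟨a, ha, hab⟩ := hJ.exists_lift (b := squarefreeExponent F)
    (by rwa [support_squarefreeExponent])
  have h : ∀ j, a (some j) + (if j = i then a none else 0) = if j ∈ F then 1 else 0 := by
    intro j
    rw [← specializeExponent_apply, hab, squarefreeExponent_apply]
  have hi := h i
  rw [if_pos rfl, if_neg hiF] at hi
  suffices e : liftExponent F = a by rwa [e]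
  ext (_ | j)
  · rw [liftExponent_none]
    omega
  · rw [liftExponent_some, ← h j]
    split_ifs <;> omega

/-- A monomial lift of `x_i x_F` has total degree one in `x_i` and `y`, which leaves two candidates.
-/
lemma liftExponent_add_mem (hJ : IsSeparation (Δ.stanleyReisnerIdeal K) i J) {F : Finset V}
    (hF : F ∈ Δ.nonJoinable {i}) :
    monomial (liftExponent F + Finsupp.single none 1) (1 : K) ∈ J ∨
      monomial (liftExponent F + Finsupp.single (some i) 1) (1 : K) ∈ J := by
  obtain ⟨-, hiF, hF⟩ := mem_nonJoinable_singleton.mp hF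
  obtain ⟨a, ha, hab⟩ := hJ.exists_lift (b := squarefreeExponent F + Finsupp.single i 1)
    (by rwa [support_add_single])
  have h : ∀ j, a (some j) + (if j = i then a none else 0) =
      (if j ∈ F then 1 else 0) + if j = i then 1 else 0 := by
    intro j
    rw [← specializeExponent_apply, hab, Finsupp.add_apply, squarefreeExponent_apply,
      Finsupp.single_apply]
    simp only [eq_comm]
  have hi := h i
  rw [if_pos rfl, if_neg hiF, if_pos rfl] at hi
  have hj : ∀ j, j ≠ i → a (some j) = if j ∈ F then 1 else 0 := by
    intro j hji
    have := h j
    rwa [if_neg hji, if_neg hji] at this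
  by_cases h0 : a none = 0
  · right
    suffices e : liftExponent F + Finsupp.single (some i) 1 = a by rwa [e]
    ext (_ | j)
    · simp [liftExponent_none, h0]
    · rw [Finsupp.add_apply, liftExponent_some]
      by_cases hji : j = i
      · subst hji
        rw [if_neg hiF, Finsupp.single_eq_same]
        omega
      · rw [hj j hji, Finsupp.single_eq_of_ne (by simp [hji]), add_zero]
  · left
    suffices e : liftExponent F + Finsupp.single none 1 = a by rwa [e]
    ext (_ | j)
    · rw [Finsupp.add_apply, liftExponent_none, Finsupp.single_eq_same]
      omega
    · rw [Finsupp.add_apply, liftExponent_some, Finsupp.single_eq_of_ne (by simp), add_zero]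
      by_cases hji : j = i
      · subst hji
        rw [if_neg hiF]
        omega
      · rw [hj j hji]

/-- Otherwise the nonzerodivisor `y - x_i` would put `x_F` into `J`, and specialising would make `F`
a non-face. -/
lemma not_liftExponent_add_mem_and (hJ : IsSeparation (Δ.stanleyReisnerIdeal K) i J)
    {F : Finset V} (hF : F ∈ Δ.nonJoinable {i}) :
    ¬ (monomial (liftExponent F + Finsupp.single none 1) (1 : K) ∈ J ∧
      monomial (liftExponent F + Finsupp.single (some i) 1) (1 : K) ∈ J) := by
  rintro ⟨h₁, h₂⟩
  obtain ⟨hF, hiF, -⟩ := mem_nonJoinable_singleton.mp hF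
  refine hJ.support_notMem
    (monomial_mem_of_sub_nonZeroDivisor (fun f hf => hJ.mem_of_sub_mul_mem hf) h₁ h₂)
    (Δ.lower ?_ hF)
  intro j hj
  rw [Finsupp.mem_support_iff, specializeExponent_apply, liftExponent_some, liftExponent_none]
    at hj
  by_contra hjF
  simp [hjF] at hj

/-- If all vertices of `G_{i}(Δ)` are separated towards the variable `u ∈ {x_i, y}`, then the other
variable `v` divides no minimal generator. -/
lemma apply_eq_zero_of_isMinimalGenerator (hJ : IsSeparation (Δ.stanleyReisnerIdeal K) i J)
    {u v : Option V} (huv : u = none ∧ v = some i ∨ u = some i ∧ v = none)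
    (h : ∀ F ∈ Δ.nonJoinable {i},
      monomial (liftExponent F + Finsupp.single u 1) (1 : K) ∈ J)
    {a : Option V →₀ ℕ} (ha : IsMinimalGenerator J a) : a v = 0 := by
  by_contra hav
  have hne : u ≠ v := by rcases huv with ⟨rfl, rfl⟩ | ⟨rfl, rfl⟩ <;> simp
  have hi : i ∉ restSupport i a := notMem_restSupport a
  have hlv : liftExponent (restSupport i a) v = 0 := by
    rcases huv with ⟨-, rfl⟩ | ⟨-, rfl⟩
    · rw [liftExponent_some, if_neg hi]
    · rw [liftExponent_none]
  have hlu : liftExponent (restSupport i a) u = 0 := by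
    rcases huv with ⟨rfl, -⟩ | ⟨rfl, -⟩
    · rw [liftExponent_none]
    · rw [liftExponent_some, if_neg hi]
  have hle := liftExponent_restSupport_le (i := i) a
  by_cases hΔ : restSupport i a ∈ Δ
  · have hN : restSupport i a ∈ Δ.nonJoinable {i} := mem_nonJoinable_singleton.mpr
      ⟨hΔ, hi, fun h => hJ.support_notMem ha.1 (Δ.lower (support_specializeExponent_subset a) h)⟩
    -- Both cases contradict minimality. If `u` does not divide `x^a`, then `u` and `v` both
    -- multiply `x^a / v` into `J`, so `x^a / v` is in `J`. If it does, `u x_F` is a divisor of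
    -- `x^a` in `J` free of `v`, where `F` is the rest support.
    by_cases hau : a u = 0
    · have hva : Finsupp.single v 1 ≤ a := by
        rw [Finsupp.single_le_iff]
        omega
      have hmem : monomial (a - Finsupp.single v 1) (1 : K) ∈ J := by
        have h₁ : monomial (a - Finsupp.single v 1 + Finsupp.single v 1) (1 : K) ∈ J := by
          rw [tsub_add_cancel_of_le hva]
          exact ha.1
        have h₂ : monomial (a - Finsupp.single v 1 + Finsupp.single u 1) (1 : K) ∈ J := by
          refine monomial_mem_of_le (add_le_add_left ?_ _) (h _ hN) 1
          intro o
          rw [Finsupp.tsub_apply]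
          by_cases hov : o = v
          · rw [hov, hlv]
            exact Nat.zero_le _
          · rw [Finsupp.single_eq_of_ne hov, tsub_zero]
            exact hle o
        rcases huv with ⟨rfl, rfl⟩ | ⟨rfl, rfl⟩
        · exact monomial_mem_of_sub_nonZeroDivisor (fun f hf => hJ.mem_of_sub_mul_mem hf) h₂ h₁
        · exact monomial_mem_of_sub_nonZeroDivisor (fun f hf => hJ.mem_of_sub_mul_mem hf) h₁ h₂
      have := ha.2 hmem tsub_le_self v
      rw [Finsupp.tsub_apply, Finsupp.single_eq_same] at this
      omega
    · have hle' : liftExponent (restSupport i a) + Finsupp.single u 1 ≤ a := by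
        intro o
        rw [Finsupp.add_apply]
        by_cases hou : o = u
        · rw [hou, hlu, Finsupp.single_eq_same]
          omega
        · rw [Finsupp.single_eq_of_ne hou, add_zero]
          exact hle o
      have := ha.2 (h _ hN) hle' v
      rw [Finsupp.add_apply, hlv, Finsupp.single_eq_of_ne hne.symm] at this
      omega
  · have := ha.2 (hJ.liftExponent_mem hi hΔ) hle v
    omega

lemma not_preconnected (hJ : IsSeparation (Δ.stanleyReisnerIdeal K) i J) :
    ¬ (Δ.inclusionGraph {i}).Preconnected := by
  intro h
  have hup : ∀ (o : Option V) {F G : Finset V}, F ⊆ G →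
      monomial (liftExponent F + Finsupp.single o 1) (1 : K) ∈ J →
      monomial (liftExponent G + Finsupp.single o 1) (1 : K) ∈ J := fun o F G hFG hF =>
    monomial_mem_of_le (add_le_add_left (liftExponent_mono hFG) _) hF 1
  have key := preconnected_inclusionGraph_iff.mp h
    {F | monomial (liftExponent F + Finsupp.single (some i) 1) (1 : K) ∈ J} (by
      intro F hF G hG hFG
      refine ⟨hup _ hFG, fun hGJ => (hJ.liftExponent_add_mem hF).resolve_left fun hFJ => ?_⟩
      exact hJ.not_liftExponent_add_mem_and hG ⟨hup _ hFG hFJ, hGJ⟩)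
  by_cases hall : ∀ F ∈ Δ.nonJoinable {i},
      monomial (liftExponent F + Finsupp.single (some i) 1) (1 : K) ∈ J
  · obtain ⟨a, ha, hdvd⟩ := hJ.y_dvd
    exact X_dvd_monomial_one_iff.mp hdvd
      (hJ.apply_eq_zero_of_isMinimalGenerator (Or.inr ⟨rfl, rfl⟩) hall ha)
  · push Not at hall
    obtain ⟨G, hG, hGJ⟩ := hall
    obtain ⟨a, ha, hdvd⟩ := hJ.x_dvd
    refine X_dvd_monomial_one_iff.mp hdvd
      (hJ.apply_eq_zero_of_isMinimalGenerator (Or.inl ⟨rfl, rfl⟩) (fun F hF => ?_) ha)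
    exact (hJ.liftExponent_add_mem hF).resolve_right fun hFJ => hGJ (key F hF G hG hFJ)

end IsSeparation

/-! ### The separation attached to a saturated set -/

namespace SimplicialCpx

variable [DecidableEq V]

/-- The exponents of the monomials in the separation attached to a set `C` of vertices of
`G_{i}(Δ)`: the vertices in `C` are joined with `x_i`, the others with `y`. -/
def separationExponents (Δ : SimplicialCpx V) (i : V) (C : Set (Finset V)) :
    Set (Option V →₀ ℕ) :=
  {a | restSupport i a ∉ Δ ∨
    (a (some i) ≠ 0 ∧ ∃ F ∈ Δ.nonJoinable {i}, F ∈ C ∧ F ⊆ restSupport i a) ∨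
    (a none ≠ 0 ∧ ∃ F ∈ Δ.nonJoinable {i}, F ∉ C ∧ F ⊆ restSupport i a)}

/-- The ideal of `S[y]` spanned by the monomials with exponents in `separationExponents`. -/
def separationIdeal (K : Type*) [Field K] (Δ : SimplicialCpx V) (i : V) (C : Set (Finset V)) :
    Ideal (MvPolynomial (Option V) K) :=
  Ideal.span ((fun a => monomial a (1 : K)) '' Δ.separationExponents i C)

variable {C : Set (Finset V)}

lemma isMonomialIdeal_separationIdeal : IsMonomialIdeal (Δ.separationIdeal K i C) :=
  ⟨_, rfl⟩

lemma monomial_mem_separationIdeal {a : Option V →₀ ℕ} :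
    monomial a (1 : K) ∈ Δ.separationIdeal K i C ↔ a ∈ Δ.separationExponents i C := by
  rw [separationIdeal, monomial_mem_span_iff]
  refine ⟨?_, fun h => ⟨a, h, le_rfl⟩⟩
  rintro ⟨b, hb, hba⟩
  have hsub := restSupport_mono (i := i) hba
  rcases hb with h | ⟨h, F, hF, hFC, hFb⟩ | ⟨h, F, hF, hFC, hFb⟩
  · exact Or.inl fun ha => h (Δ.lower hsub ha)
  · have := hba (some i)
    exact Or.inr (Or.inl ⟨by omega, F, hF, hFC, hFb.trans hsub⟩)
  · have := hba none
    exact Or.inr (Or.inr ⟨by omega, F, hF, hFC, hFb.trans hsub⟩)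

lemma insert_restSupport_notMem {a : Option V →₀ ℕ} {F : Finset V}
    (hF : F ∈ Δ.nonJoinable {i}) (hFa : F ⊆ restSupport i a) :
    insert i (restSupport i a) ∉ Δ := fun h =>
  (mem_nonJoinable_singleton.mp hF).2.2 (Δ.lower (Finset.insert_subset_insert i hFa) h)

lemma support_notMem_of_mem_separationExponents {a : Option V →₀ ℕ}
    (ha : a ∈ Δ.separationExponents i C) : (specializeExponent i a).support ∉ Δ := by
  have aux : (a none ≠ 0 ∨ a (some i) ≠ 0) → ∀ F ∈ Δ.nonJoinable {i}, F ⊆ restSupport i a →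
      (specializeExponent i a).support ∉ Δ := fun h F hF hFa hΔ =>
    insert_restSupport_notMem hF hFa (Δ.lower (Finset.insert_subset
      (mem_support_specializeExponent h) (restSupport_subset_support a)) hΔ)
  rcases ha with h | ⟨h, F, hF, -, hFa⟩ | ⟨h, F, hF, -, hFa⟩
  · exact fun hΔ => h (Δ.lower (restSupport_subset_support a) hΔ)
  · exact aux (Or.inr h) F hF hFa
  · exact aux (Or.inl h) F hF hFa

lemma exists_mem_separationExponents {b : V →₀ ℕ} (hb : b.support ∉ Δ) :
    ∃ a ∈ Δ.separationExponents i C, specializeExponent i a = b := by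
  have hrest : ∀ a : Option V →₀ ℕ, (∀ j, j ≠ i → a (some j) = b j) →
      restSupport i a = b.support.erase i := by
    intro a ha
    ext j
    rw [mem_restSupport, Finset.mem_erase, Finsupp.mem_support_iff]
    exact and_congr_right fun hj => by rw [ha j hj]
  have hx : ∀ j, b.mapDomain some (some j) = b j :=
    Finsupp.mapDomain_apply (Option.some_injective V) b
  have hx' : specializeExponent i (b.mapDomain some) = b := by
    rw [specializeExponent, ← Finsupp.mapDomain_comp]
    exact Finsupp.mapDomain_id
  by_cases hΔ : b.support.erase i ∈ Δ
  · obtain ⟨h0, hN⟩ := erase_support_mem_nonJoinable hb hΔ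
    by_cases hC : b.support.erase i ∈ C
    · refine ⟨b.mapDomain some, Or.inr (Or.inl ⟨by rwa [hx], _, hN, hC, ?_⟩), hx'⟩
      rw [hrest _ fun j _ => hx j]
    -- A section of the specialisation that renames `x_i` to `y`, so the whole power of `x_i`
    -- becomes a power of `y`.
    · let s : V → Option V := fun j => if j = i then none else some j
      have hs : Function.LeftInverse (fun o : Option V => o.elim i id) s := by
        intro j
        by_cases hj : j = i <;> simp [s, hj]
      have hy : ∀ j, b.mapDomain s (s j) = b j := Finsupp.mapDomain_apply hs.injective b
      refine ⟨b.mapDomain s, Or.inr (Or.inr ⟨?_, _, hN, hC, ?_⟩), ?_⟩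
      · have := hy i
        rw [show s i = none from if_pos rfl] at this
        rwa [this]
      · rw [hrest]
        intro j hj
        have := hy j
        rwa [show s j = some j from if_neg hj] at this
      · rw [specializeExponent, ← Finsupp.mapDomain_comp, hs.comp_eq_id, Finsupp.mapDomain_id]
  · refine ⟨b.mapDomain some, Or.inl ?_, hx'⟩
    rwa [hrest _ fun j _ => hx j]

lemma image_separationIdeal :
    specializeY i '' (Δ.separationIdeal K i C : Set (MvPolynomial (Option V) K)) =
      Δ.stanleyReisnerIdeal K := by
  apply Set.Subset.antisymm
  · rintro _ ⟨f, hf, rfl⟩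
    refine isMonomialIdeal_separationIdeal.induction
      (p := fun f => specializeY i f ∈ Δ.stanleyReisnerIdeal K) ?_ ?_ ?_ hf
    · rw [map_zero]
      exact Ideal.zero_mem _
    · intro f g hf hg
      rw [map_add]
      exact Ideal.add_mem _ hf hg
    · intro a r ha
      rw [specializeY_monomial]
      exact monomial_mem_of_le le_rfl (monomial_mem_stanleyReisnerIdeal.mpr
        (support_notMem_of_mem_separationExponents (monomial_mem_separationIdeal.mp ha))) r
  · intro f hf
    refine (Δ.isMonomialIdeal_stanleyReisnerIdeal K).induction
      (p := fun f => f ∈ specializeY i '' (Δ.separationIdeal K i C : Set _)) ?_ ?_ ?_ hf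
    · exact ⟨0, Ideal.zero_mem _, map_zero _⟩
    · rintro _ _ ⟨f, hf, rfl⟩ ⟨g, hg, rfl⟩
      exact ⟨f + g, Ideal.add_mem _ hf hg, map_add _ _ _⟩
    · intro b r hb
      obtain ⟨a, ha, rfl⟩ :=
        exists_mem_separationExponents (i := i) (C := C) (monomial_mem_stanleyReisnerIdeal.mp hb)
      exact ⟨monomial a r, monomial_mem_of_le le_rfl (monomial_mem_separationIdeal.mpr ha) r,
        specializeY_monomial i a r⟩

/-- For a monomial outside the ideal, the rest support is a face; if it contained vertices both in
and outside `C`, it would be a vertex itself, and saturation would be violated. So one of `x_i`, `y`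
cannot multiply the monomial into the ideal, and that variable serves as `u` in
`coeff_eq_zero_of_sub_mul_mem`. -/
lemma mem_separationIdeal_of_sub_mul_mem
    (hC : ∀ F ∈ Δ.nonJoinable {i}, ∀ G ∈ Δ.nonJoinable {i}, F ⊆ G → (F ∈ C ↔ G ∈ C))
    {f : MvPolynomial (Option V) K}
    (hf : (X none - X (some i)) * f ∈ Δ.separationIdeal K i C) :
    f ∈ Δ.separationIdeal K i C := by
  rw [isMonomialIdeal_separationIdeal.mem_iff]
  intro a ha
  rw [mem_support_iff] at ha
  by_contra haJ
  rw [monomial_mem_separationIdeal] at haJ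
  have hrest : ∀ b c : Option V →₀ ℕ, (∀ j, j ≠ i → b (some j) = c (some j)) →
      restSupport i b = restSupport i c := fun _ _ => restSupport_congr
  by_cases hB : ∃ G ∈ Δ.nonJoinable {i}, G ∉ C ∧ G ⊆ restSupport i a
  · have hA : ¬ ∃ F ∈ Δ.nonJoinable {i}, F ∈ C ∧ F ⊆ restSupport i a := by
      rintro ⟨F, hF, hFC, hFa⟩
      obtain ⟨G, hG, hGC, hGa⟩ := hB
      have hN : restSupport i a ∈ Δ.nonJoinable {i} := mem_nonJoinable_singleton.mpr
        ⟨not_not.mp fun h => haJ (Or.inl h), notMem_restSupport a,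
          insert_restSupport_notMem hF hFa⟩
      exact hGC ((hC G hG _ hN hGa).mpr ((hC F hF _ hN hFa).mp hFC))
    have hf' : (X (some i) - X none) * f ∈ Δ.separationIdeal K i C := by
      rw [← neg_sub, neg_mul]
      exact neg_mem hf
    refine ha (isMonomialIdeal_separationIdeal.coeff_eq_zero_of_sub_mul_mem hf'
      (fun b => b ∉ Δ.separationExponents i C ∧
        ¬ ∃ F ∈ Δ.nonJoinable {i}, F ∈ C ∧ F ⊆ restSupport i b) ?_ ?_ (by simp) a ⟨haJ, hA⟩)
    · rintro b ⟨hbJ, hbA⟩ hb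
      rw [monomial_mem_separationIdeal, separationExponents, Set.mem_ofPred_eq,
        hrest (b + Finsupp.single (some i) 1) b fun j hj => by simp [hj]] at hb
      rcases hb with h | h | h
      · exact hbJ (Or.inl h)
      · exact hbA h.2
      · refine hbJ (Or.inr (Or.inr ⟨?_, h.2⟩))
        simpa using h.1
    · rintro b ⟨hbJ, hbA⟩
      refine or_iff_not_imp_right.mpr fun hb0 => ?_
      -- Trading `y` for `x_i` does not change the rest support, so the predicate survives the
      -- shift.
      have hr := hrest (b + Finsupp.single (some i) 1 - Finsupp.single none 1) b
        fun j hj => by simp [hj]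
      rw [separationExponents, Set.mem_ofPred_eq, hr]
      refine ⟨?_, hbA⟩
      rintro (h | h | h)
      · exact hbJ (Or.inl h)
      · exact hbA h.2
      · exact hbJ (Or.inr (Or.inr ⟨hb0, h.2⟩))
  · refine ha (isMonomialIdeal_separationIdeal.coeff_eq_zero_of_sub_mul_mem hf
      (fun b => b ∉ Δ.separationExponents i C ∧
        ¬ ∃ F ∈ Δ.nonJoinable {i}, F ∉ C ∧ F ⊆ restSupport i b) ?_ ?_ (by simp) a ⟨haJ, hB⟩)
    · rintro b ⟨hbJ, hbB⟩ hb
      rw [monomial_mem_separationIdeal, separationExponents, Set.mem_ofPred_eq,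
        hrest (b + Finsupp.single none 1) b fun j hj => by simp] at hb
      rcases hb with h | h | h
      · exact hbJ (Or.inl h)
      · refine hbJ (Or.inr (Or.inl ⟨?_, h.2⟩))
        simpa using h.1
      · exact hbB h.2
    · rintro b ⟨hbJ, hbB⟩
      refine or_iff_not_imp_right.mpr fun hb0 => ?_
      have hr := hrest (b + Finsupp.single none 1 - Finsupp.single (some i) 1) b
        fun j hj => by simp [hj]
      rw [separationExponents, Set.mem_ofPred_eq, hr]
      refine ⟨?_, hbB⟩
      rintro (h | h | h)
      · exact hbJ (Or.inl h)
      · exact hbJ (Or.inr (Or.inl ⟨hb0, h.2⟩))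
      · exact hbB h.2

lemma isSeparation_separationIdeal
    (hC : ∀ F ∈ Δ.nonJoinable {i}, ∀ G ∈ Δ.nonJoinable {i}, F ⊆ G → (F ∈ C ↔ G ∈ C))
    {F G : Finset V} (hF : F ∈ Δ.nonJoinable {i}) (hFC : F ∈ C)
    (hG : G ∈ Δ.nonJoinable {i}) (hGC : G ∉ C) :
    IsSeparation (Δ.stanleyReisnerIdeal K) i (Δ.separationIdeal K i C) where
  isMonomialIdeal := isMonomialIdeal_separationIdeal
  image_eq := image_separationIdeal
  x_dvd := by
    obtain ⟨hFΔ, hiF, -⟩ := mem_nonJoinable_singleton.mp hF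
    have hr := restSupport_liftExponent_add hiF (Or.inr rfl)
    have hmem : monomial (liftExponent F + Finsupp.single (some i) 1) (1 : K) ∈
        Δ.separationIdeal K i C := by
      rw [monomial_mem_separationIdeal]
      exact Or.inr (Or.inl ⟨by simp, F, hF, hFC, hr.ge⟩)
    -- A minimal generator below `x_i x_F` has its rest support inside the face `F` and is free of
    -- `y`; only the clause requiring `x_i` can hold. The argument for `y` is symmetric.
    obtain ⟨b, hle, hb⟩ := exists_isMinimalGenerator_le hmem
    refine ⟨b, hb, X_dvd_monomial_one_iff.mpr ?_⟩
    rcases monomial_mem_separationIdeal.mp hb.1 with h | h | h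
    · exact absurd (Δ.lower ((restSupport_mono hle).trans hr.le) hFΔ) h
    · exact h.1
    · have := hle none
      rw [Finsupp.add_apply, liftExponent_none, Finsupp.single_eq_of_ne (by simp)] at this
      exact absurd (Nat.le_zero.mp this) h.1
  y_dvd := by
    obtain ⟨hGΔ, hiG, -⟩ := mem_nonJoinable_singleton.mp hG
    have hr := restSupport_liftExponent_add hiG (Or.inl rfl)
    have hmem : monomial (liftExponent G + Finsupp.single none 1) (1 : K) ∈
        Δ.separationIdeal K i C := by
      rw [monomial_mem_separationIdeal]
      exact Or.inr (Or.inr ⟨by simp, G, hG, hGC, hr.ge⟩)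
    obtain ⟨b, hle, hb⟩ := exists_isMinimalGenerator_le hmem
    refine ⟨b, hb, X_dvd_monomial_one_iff.mpr ?_⟩
    rcases monomial_mem_separationIdeal.mp hb.1 with h | h | h
    · exact absurd (Δ.lower ((restSupport_mono hle).trans hr.le) hGΔ) h
    · have := hle (some i)
      rw [Finsupp.add_apply, liftExponent_some, if_neg hiG,
        Finsupp.single_eq_of_ne (by simp)] at this
      exact absurd (Nat.le_zero.mp this) h.1
    · exact h.1
  nonZeroDivisor :=
    mk_mem_nonZeroDivisors_iff.mpr fun _ hf => mem_separationIdeal_of_sub_mul_mem hC hf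

theorem isInseparable_iff_preconnected :
    Δ.IsInseparable K ↔ ∀ i, (Δ.inclusionGraph {i}).Preconnected := by
  constructor
  · intro h i
    rw [preconnected_inclusionGraph_iff]
    intro C hC F hF G hG hFC
    by_contra hGC
    exact h ⟨i, _, isSeparation_separationIdeal hC hF hFC hG hGC⟩
  · rintro h ⟨i, J, hJ⟩
    exact hJ.not_preconnected (h i)

end SimplicialCpx

end SeparationCriterion

end

theorem mainTheorem2 (K : Type*) [Field K] {n : ℕ} (Δ : SimplicialCpx (Fin n)) :
    List.TFAE
      [Δ.IsInseparable K,
       ∀ i : Fin n, (Δ.inclusionGraph {i}).Preconnected,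
       ∀ i : Fin n,
        cotangentT1Component (Δ.stanleyReisnerIdeal K) (-(Pi.single i 1 : Fin n → ℤ)) = ⊥] := by
  tfae_have 1 ↔ 2 := SimplicialCpx.isInseparable_iff_preconnected
  tfae_have 2 ↔ 3 :=
    forall_congr' fun _ => SimplicialCpx.preconnected_iff_cotangentT1Component_eq_bot
  tfae_finish
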